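/- Let $\mathrm G$ be a simple, undirected, connected graph on $\{1,\dots,n\}$ with neighbour sets $\mathrm N_i$, let $f_1,\dots,f_n:\{0,1\}^m\to\{0,1\}$ and $\sigma_1,\dots,\sigma_n\in\{0,1\}$, and assume that the Boolean system $f_i(x)=\sigma_i$ ($i=1,\dots,n$) has at least one solution. Put $d=2^m$, let $\Delta=\{\delta^1,\dots,\delta^{d}\}$ be the set of columns of the $d\times d$ identity matrix (the Boolean vectors), and let $\Theta:\{0,1\}^m\to\Delta$, $\Theta(x)=\delta^{1+\sum_k x_k2^{m-k}}$, with inverse $\Upsilon$. Let $\mathbf M_{f_i}\in\mathbb R^{2\times d}$ be the matrix whose column at $\Theta(x)$ is $\mathbf e_{f_i(x)}$, where $\mathbf e_0=(1,0)^\top$ and $\mathbf e_1=(0,1)^\top$; let $\mathcal P_i$ be the orthogonal projection onto $\mathcal E_i=\{\mathbf y\in\mathbb R^{d}:\mathbf M_{f_i}\mathbf y=\mathbf e_{\sigma_i}\}$ and $\mathcal P_*$ the one onto $\mathcal E=\bigcap_i\mathcal E_i$. Fix a step size $0<\eta<1/n$ and consider projection consensus $$\mathbf x_i(t+1)=\mathcal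 P_i\Big(\mathbf x_i(t)+\eta\sum_{j\in \mathrm N_i}\big(\mathbf x_j(t)-\mathbf x_i(t)\big)\Big),\qquad i=1,\dots,n .$$ Then there are constants $C_0,\gamma_0>0$ such that $$\Big\|\mathbf x_i(T)-\tfrac1n\sum_{k=1}^n\mathcal P_*(\mathbf x_k(0))\Big\|\le C_0e^{-\gamma_0T}\quad\text{for all } i,\ \text{all } T\ge 0 \text{ and all } \mathbf x_1(0),\dots,\mathbf x_n(0)\in[0,1]^{d}. \qquad(*)$$ Moreover, let $C_0,\gamma_0>0$ be any constants satisfying $(*)$, and fix $C_*\ge C_0$ and $0<\gamma_*\le\gamma_0$. Let $\boldsymbol\beta_{i,s}$, $1\le i\le n$, $1\le s\le 2^m+1$, be independent and uniformly distributed on $[0,1]^{d}$. The algorithm ExtendedDistributedBooleanEquationSolver with parameter $T$ works as follows. For each $s$, run $T$ steps of projection consensus from $\mathbf x_i(0)=\boldsymbol\beta_{i,s}$, and let $\widehat{\mathbf y}_{i,s}=\mathbf x_i(T)$. With $\epsilon_T=C_*e^{-\gamma_*T}(2^m+1)$, each node $i$ considers the nonempty affine subspaces $\mathcal A$ of $\mathbb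 R^{d}$ with $\sum_{s=1}^{2^m+1}\mathrm{dist}(\widehat{\mathbf y}_{i,s},\mathcal A)\le\epsilon_T$; among these, the ones of minimal dimension; and among the latter picks one, $\mathcal A_i$, for which $\mathrm{Card}(\mathcal A\cap\Delta)$ is maximal. It returns $\mathcal S_i=\Upsilon(\mathcal A_i\cap\Delta)$. Such an $\mathcal A_i$ need not be unique. For every node $i=1,\dots,n$, $$\lim_{T\to\infty}\mathbb P\big(\text{a maximizer } \mathcal A_i \text{ exists and every choice of it gives } \mathcal S_i=\{x\in\{0,1\}^m: f_j(x)=\sigma_j,\ j=1,\dots,n\}\big)=1 .$$ -/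

import Mathlib

open MeasureTheory ProbabilityTheory Filter Topology

noncomputable section

namespace BoolNet

/-! ### Boolean equations and Boolean vectors -/

/-- Boolean assignments with `m` variables, the set `{0,1}^m`. -/
abbrev Assign (m : ℕ) : Type := Fin m → Fin 2

/-- The Euclidean space of dimension `d`, with its `ℓ²` norm. -/
abbrev Vec (d : ℕ) : Type := EuclideanSpace ℝ (Fin d)

/-- The solution set of the system `f_i(x) = σ_i`, `i = 1, …, n`. -/
def solutionSet {n m : ℕ} (f : Fin n → Assign m → Fin 2) (σ : Fin n → Fin 2) :
    Set (Assign m) :=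
  {x | ∀ i, f i x = σ i}

/-- The bijection between `{0,1}^m` and the indices of the coordinates of `ℝ^(2^m)`: the binary
number with digits `x_1 … x_m`, most significant digit first (indices start at `0`). -/
def index (m : ℕ) : Assign m ≃ Fin (2 ^ m) :=
  (Equiv.arrowCongr Fin.revPerm (Equiv.refl (Fin 2))).trans finFunctionFinEquiv

theorem index_val (m : ℕ) (x : Assign m) :
    (index m x : ℕ) = ∑ k : Fin m, (x k : ℕ) * 2 ^ (m - 1 - (k : ℕ)) := by
  simp only [index, Equiv.trans_apply, finFunctionFinEquiv_apply]
  refine Fintype.sum_equiv Fin.revPerm _ _ fun k => ?_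
  have h : m - 1 - ((Fin.rev k : Fin m) : ℕ) = k := by
    rw [Fin.val_rev]; omega
  change (x (Fin.rev k) : ℕ) * 2 ^ (k : ℕ)
    = (x (Fin.rev k) : ℕ) * 2 ^ (m - 1 - ((Fin.rev k : Fin m) : ℕ))
  rw [h]

/-- The `i`-th column of the identity matrix of size `c`. -/
def delta (c : ℕ) (i : Fin c) : Vec c := EuclideanSpace.single i 1

/-- The set of Boolean vectors, i.e. of all columns of the identity matrix of size `c`. -/
def booleanVectors (c : ℕ) : Set (Vec c) := Set.range (delta c)

/-- The vector form `Θ_m(x)` of a Boolean assignment `x`. -/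
def theta (m : ℕ) (x : Assign m) : Vec (2 ^ m) := delta (2 ^ m) (index m x)

/-- The image `Υ_m(S)` of a set `S` of Boolean vectors under the inverse of `Θ_m`. -/
def upsilonImage (m : ℕ) (S : Set (Vec (2 ^ m))) : Set (Assign m) :=
  {x | ∃ j : Fin (2 ^ m), delta (2 ^ m) j ∈ S ∧ (index m).symm j = x}

/-- The `2 × 2^m` matrix of a Boolean mapping `g`: its `j`-th column is the vector form of the
value of `g` at the `j`-th assignment. -/
def booleanMatrix {m : ℕ} (g : Assign m → Fin 2) : Matrix (Fin 2) (Fin (2 ^ m)) ℝ :=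
  Matrix.of fun r j => delta 2 (g ((index m).symm j)) r

/-! ### Linear equations and projection consensus -/

/-- The affine space of the solutions `y` of `H y = z`. -/
def linearSolutions {k d : ℕ} (H : Matrix (Fin k) (Fin d) ℝ) (z : Vec k) :
    AffineSubspace ℝ (Vec d) where
  carrier := {y | H.toEuclideanLin y = z}
  smul_vsub_vadd_mem' := by
    intro c p₁ p₂ p₃ h₁ h₂ h₃
    change H.toEuclideanLin p₁ = z at h₁
    change H.toEuclideanLin p₂ = z at h₂
    change H.toEuclideanLin p₃ = z at h₃
    change H.toEuclideanLin (c • (p₁ -ᵥ p₂) +ᵥ p₃) = z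
    simp only [vsub_eq_sub, vadd_eq_add, map_add, map_smul, map_sub, h₁, h₂, h₃, sub_self,
      smul_zero, zero_add]

/-- The affine space of the lifted equation `M_g y = Θ_1(b)` of one node. -/
def nodeSpace {m : ℕ} (g : Assign m → Fin 2) (b : Fin 2) : AffineSubspace ℝ (Vec (2 ^ m)) :=
  linearSolutions (booleanMatrix g) (delta 2 b)

/-- The solution space of the whole induced linear system, the intersection of the spaces of
the nodes. -/
def networkSpace {n m : ℕ} (f : Fin n → Assign m → Fin 2) (σ : Fin n → Fin 2) :
    AffineSubspace ℝ (Vec (2 ^ m)) :=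
  ⨅ i, nodeSpace (f i) (σ i)

open Classical in
/-- The orthogonal projection onto a nonempty affine subspace (the identity, by convention, if the
subspace is empty). -/
def affineProj {d : ℕ} (A : AffineSubspace ℝ (Vec d)) (x : Vec d) : Vec d :=
  if h : Nonempty A then
    haveI := h
    (EuclideanGeometry.orthogonalProjection A x : Vec d)
  else x

/-- The projection consensus recursion with step size `η`, started at `x₀`:
`x_i(t+1) = P_i (x_i(t) + η ∑_{j ∈ N_i} (x_j(t) - x_i(t)))`. -/
def consensus {n d : ℕ} (G : SimpleGraph (Fin n)) [DecidableRel G.Adj] (η : ℝ)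
    (A : Fin n → AffineSubspace ℝ (Vec d)) (x₀ : Fin n → Vec d) : ℕ → Fin n → Vec d
  | 0 => x₀
  | t + 1 => fun i =>
      affineProj (A i) (consensus G η A x₀ t i +
        η • ∑ j ∈ G.neighborFinset i, (consensus G η A x₀ t j - consensus G η A x₀ t i))

/-- The state of node `i` after `T` steps of projection consensus for the lifted equations. -/
def nodeState {n m : ℕ} (G : SimpleGraph (Fin n)) [DecidableRel G.Adj] (η : ℝ)
    (f : Fin n → Assign m → Fin 2) (σ : Fin n → Fin 2) (x₀ : Fin n → Vec (2 ^ m))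
    (T : ℕ) (i : Fin n) : Vec (2 ^ m) :=
  consensus G η (fun k => nodeSpace (f k) (σ k)) x₀ T i

/-- The exact output `(1/n) ∑_k P_*(x_k(0))` of projection consensus. -/
def exactLimit {n m : ℕ} (f : Fin n → Assign m → Fin 2) (σ : Fin n → Fin 2)
    (x₀ : Fin n → Vec (2 ^ m)) : Vec (2 ^ m) :=
  (n : ℝ)⁻¹ • ∑ k, affineProj (networkSpace f σ) (x₀ k)

/-- The cube `[0,1]^d`. -/
def cube (d : ℕ) : Set (Vec d) := {x | ∀ j, x j ∈ Set.Icc (0 : ℝ) 1}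

/-- `C₀ e^{-γ₀ T}` bounds the residual (the distance from the state to the exact output) at every
node and after any number `T` of steps, for all initial values in the cube. -/
def ResidualBound {n m : ℕ} (G : SimpleGraph (Fin n)) [DecidableRel G.Adj] (η : ℝ)
    (f : Fin n → Assign m → Fin 2) (σ : Fin n → Fin 2) (C₀ γ₀ : ℝ) : Prop :=
  ∀ x₀ : Fin n → Vec (2 ^ m), (∀ k, x₀ k ∈ cube (2 ^ m)) → ∀ (T : ℕ) (i : Fin n),
    ‖nodeState G η f σ x₀ T i - exactLimit f σ x₀‖ ≤ C₀ * Real.exp (-γ₀ * T)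

/-! ### The local optimization problems and the output -/

/-- A (nonempty) affine space whose total distance to the given points is at most `ε`. -/
def Feasible {N d : ℕ} (y : Fin N → Vec d) (ε : ℝ) (A : AffineSubspace ℝ (Vec d)) : Prop :=
  (A : Set (Vec d)).Nonempty ∧ ∑ s, Metric.infDist (y s) (A : Set (Vec d)) ≤ ε

/-- A feasible affine space of minimal dimension. -/
def MinimalDim {N d : ℕ} (y : Fin N → Vec d) (ε : ℝ) (A : AffineSubspace ℝ (Vec d)) : Prop :=
  Feasible y ε A ∧ ∀ B : AffineSubspace ℝ (Vec d), Feasible y ε B →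
    Module.finrank ℝ A.direction ≤ Module.finrank ℝ B.direction

/-- The Boolean vectors in an affine space. -/
def booleanPart {d : ℕ} (A : AffineSubspace ℝ (Vec d)) : Set (Vec d) :=
  (A : Set (Vec d)) ∩ booleanVectors d

/-- Among the feasible affine spaces of minimal dimension, one with the largest number of Boolean
vectors. -/
def Optimal {N d : ℕ} (y : Fin N → Vec d) (ε : ℝ) (A : AffineSubspace ℝ (Vec d)) : Prop :=
  MinimalDim y ε A ∧ ∀ B : AffineSubspace ℝ (Vec d), MinimalDim y ε B →
    (booleanPart B).ncard ≤ (booleanPart A).ncard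

/-- The tolerance `ε_T = C_* e^{-γ_* T} (2^m + 1)`. -/
def tolerance (m : ℕ) (Cs γs : ℝ) (T : ℕ) : ℝ :=
  Cs * Real.exp (-γs * T) * (2 ^ m + 1)

/-- The sets that node `i` may return when the algorithm runs projection consensus for `T` steps
from each of the `2^m + 1` families of initial values `b · s`: one set for each optimal affine
space, as the algorithm does not say which of several optimal spaces it picks. -/
def outputs {n m : ℕ} (G : SimpleGraph (Fin n)) [DecidableRel G.Adj] (η : ℝ)
    (f : Fin n → Assign m → Fin 2) (σ : Fin n → Fin 2) (Cs γs : ℝ)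
    (b : Fin n → Fin (2 ^ m + 1) → Vec (2 ^ m)) (T : ℕ) (i : Fin n) : Set (Set (Assign m)) :=
  {S | ∃ A : AffineSubspace ℝ (Vec (2 ^ m)),
    Optimal (fun s => nodeState G η f σ (fun k => b k s) T i) (tolerance m Cs γs T) A ∧
      S = upsilonImage m (booleanPart A)}

end BoolNet

end

/-!
Projection consensus is, around a point `c` of all the spaces `E_i`, the iteration of a linear map:
mix the states with the weights of the graph, then project onto the direction of `E_i` at node `i`.
Since `η < 1 / n`, mixing loses energy `∑ ‖z_i‖²` in proportion to the disagreement between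
neighbours (`sum_norm_sq_mixing_le`). Hence on the orthogonal complement of the families `(v, …, v)`
with `v` in the direction of `E = ⋂ E_i`, an invariant subspace, every nonzero vector gets strictly
shorter (`norm_consensusStep_lt`), and by compactness uniformly so. Taking for `c` the exact output
puts the initial residual into this subspace, which gives the exponential bound
(`exists_residualBound`).

For the algorithm, the exact output of run `s` is `P_E (u_s)`, where `u_s` is the average over the
nodes of the initial values. If the `d + 1` points `u_s` are affinely independent in `ℝ^d`, and `A`
is a space of total distance at most `ε_T` to the states, then the affine map which takes `u_s` to
a point of `A` near `P_E (u_s)` is a perturbation of `P_E` of size `O(ε_T)`, with a constant that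
depends on `u` only (`amplification`). When this is small, the map is injective on `E`, so that
`dim E ≤ dim A`; and if the dimensions agree, then it maps `E` onto `A`, so that the Boolean vectors
of `A` are so close to `E` that they belong to `E` (`finrank_le_and_exists_near`). As `E` is
feasible, it is optimal, and every optimal space has the same Boolean vectors as `E`
(`outputs_eq_singleton`).

The points `u_s` are almost surely affinely independent, as the determinant which tests this is a
monic polynomial along the lines of a suitable direction (`ae_det_averages_ne_zero`). So the
amplification is a finite random variable that does not depend on `T`, while `ε_T → 0`: the
probability that their product is not small tends to zero (`tendsto_measure_outputs_ne`).
-/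

noncomputable section

namespace BoolNet

/-! ### Orthogonal projections onto affine subspaces -/

theorem affineProj_eq {d : ℕ} {A : AffineSubspace ℝ (Vec d)} {p : Vec d} (hp : p ∈ A)
    (x : Vec d) : affineProj A x = p + A.direction.starProjection (x - p) := by
  have hA : Nonempty A := ⟨⟨p, hp⟩⟩
  rw [affineProj, dif_pos hA, EuclideanGeometry.coe_orthogonalProjection_eq_iff_mem]
  refine ⟨?_, ?_⟩
  · rw [add_comm]
    exact AffineSubspace.vadd_mem_of_mem_direction (Submodule.starProjection_apply_mem _ _) hp
  · rw [vsub_eq_sub, ← sub_sub]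
    exact Submodule.sub_starProjection_mem_orthogonal _

theorem affineProj_mem {d : ℕ} {A : AffineSubspace ℝ (Vec d)} (hA : (A : Set (Vec d)).Nonempty)
    (x : Vec d) : affineProj A x ∈ A := by
  obtain ⟨p, hp⟩ := hA
  rw [affineProj_eq hp, add_comm]
  exact AffineSubspace.vadd_mem_of_mem_direction (Submodule.starProjection_apply_mem _ _) hp

theorem dist_affineProj {d : ℕ} {A : AffineSubspace ℝ (Vec d)}
    (hA : (A : Set (Vec d)).Nonempty) (x : Vec d) :
    ‖affineProj A x - x‖ = Metric.infDist x (A : Set (Vec d)) := by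
  have : Nonempty A := hA.to_subtype
  rw [affineProj, dif_pos this, ← EuclideanGeometry.dist_orthogonalProjection_eq_infDist,
    dist_comm, dist_eq_norm]

theorem continuous_affineProj {d : ℕ} (A : AffineSubspace ℝ (Vec d)) :
    Continuous (affineProj A) := by
  by_cases hA : (A : Set (Vec d)).Nonempty
  · obtain ⟨p, hp⟩ := hA
    have : affineProj A = fun x => p + A.direction.starProjection (x - p) :=
      funext fun x => affineProj_eq hp x
    rw [this]
    fun_prop
  · have : affineProj A = id := by
      funext x
      exact dif_neg fun h => hA (Set.nonempty_coe_sort.1 h)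
    rw [this]
    exact continuous_id

/-- The average of the projections of `x_k` is the projection of the average of the `x_k`. -/
theorem average_affineProj {n d : ℕ} (hn : n ≠ 0) {A : AffineSubspace ℝ (Vec d)}
    (hA : (A : Set (Vec d)).Nonempty) (x : Fin n → Vec d) :
    (n : ℝ)⁻¹ • ∑ k, affineProj A (x k) = affineProj A ((n : ℝ)⁻¹ • ∑ k, x k) := by
  obtain ⟨p, hp⟩ := hA
  have hn' : (n : ℝ) ≠ 0 := Nat.cast_ne_zero.2 hn
  have h : (n : ℝ)⁻¹ • ∑ k, x k - p = (n : ℝ)⁻¹ • ∑ k, (x k - p) := by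
    rw [Finset.sum_sub_distrib, smul_sub, Finset.sum_const, Finset.card_univ, Fintype.card_fin,
      ← Nat.cast_smul_eq_nsmul ℝ, smul_smul, inv_mul_cancel₀ hn', one_smul]
  simp only [affineProj_eq hp]
  rw [h, map_smul, map_sum, Finset.sum_add_distrib, smul_add, Finset.sum_const, Finset.card_univ,
    Fintype.card_fin, ← Nat.cast_smul_eq_nsmul ℝ, smul_smul, inv_mul_cancel₀ hn', one_smul]

theorem norm_sq_le_of_mem_cube {d : ℕ} {x : Vec d} (hx : x ∈ cube d) : ‖x‖ ^ 2 ≤ d := by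
  rw [EuclideanSpace.norm_sq_eq]
  calc ∑ i, ‖x i‖ ^ 2 ≤ ∑ _i : Fin d, (1 : ℝ) := by
        refine Finset.sum_le_sum fun i _ => ?_
        obtain ⟨h0, h1⟩ := hx i
        rw [Real.norm_of_nonneg h0]
        exact pow_le_one₀ h0 h1
    _ = d := by simp

theorem norm_le_of_mem_cube {d : ℕ} {x : Vec d} (hx : x ∈ cube d) : ‖x‖ ≤ Real.sqrt d :=
  Real.le_sqrt_of_sq_le (norm_sq_le_of_mem_cube hx)

/-! ### Strict contractions of finite-dimensional spaces -/

/-- A linear map which shortens every nonzero vector of a finite-dimensional space contracts it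
uniformly, as the unit sphere is compact. -/
theorem exists_contraction_factor {F : Type*} [NormedAddCommGroup F] [NormedSpace ℝ F]
    [FiniteDimensional ℝ F] (M : F →ₗ[ℝ] F) (K : Submodule ℝ F)
    (hM : ∀ z ∈ K, z ≠ 0 → ‖M z‖ < ‖z‖) :
    ∃ ρ : ℝ, 0 < ρ ∧ ρ < 1 ∧ ∀ z ∈ K, ‖M z‖ ≤ ρ * ‖z‖ := by
  have hc : IsCompact ((K : Set F) ∩ Metric.sphere 0 1) :=
    (isCompact_sphere (0 : F) 1).inter_left K.closed_of_finiteDimensional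
  have hcont : Continuous M := M.continuous_of_finiteDimensional
  obtain ⟨ρ, hρ0, hρ1, hρ⟩ : ∃ ρ : ℝ, 0 < ρ ∧ ρ < 1 ∧
      ∀ z ∈ (K : Set F) ∩ Metric.sphere 0 1, ‖M z‖ ≤ ρ := by
    rcases ((K : Set F) ∩ Metric.sphere 0 1).eq_empty_or_nonempty with he | hne
    · exact ⟨1 / 2, by norm_num, by norm_num, fun z hz => absurd hz (by simp [he])⟩
    · obtain ⟨z, ⟨hzK, hz1⟩, hz⟩ := hc.exists_isMaxOn hne hcont.norm.continuousOn
      have hz1' : ‖z‖ = 1 := by simpa using hz1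
      have hlt : ‖M z‖ < 1 := by
        have := hM z hzK (fun h => by simp [h] at hz1')
        rwa [hz1'] at this
      refine ⟨(1 + ‖M z‖) / 2, by positivity, by linarith, fun w hw => ?_⟩
      have : ‖M w‖ ≤ ‖M z‖ := hz hw
      linarith
  refine ⟨ρ, hρ0, hρ1, fun z hz => ?_⟩
  rcases eq_or_ne z 0 with rfl | h0
  · simp
  · have hn : 0 < ‖z‖ := norm_pos_iff.2 h0
    have := hρ (‖z‖⁻¹ • z) ⟨K.smul_mem _ hz, by simp [norm_smul, hn.ne']⟩
    rw [map_smul, norm_smul, norm_inv, norm_norm, inv_mul_le_iff₀ hn] at this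
    linarith

/-! ### One step of projection consensus -/

section Step

variable {n d : ℕ} (G : SimpleGraph (Fin n)) [DecidableRel G.Adj]

theorem sum_neighbor_comm {M : Type*} [AddCommMonoid M] (F : Fin n → Fin n → M) :
    ∑ i, ∑ j ∈ G.neighborFinset i, F i j = ∑ i, ∑ j ∈ G.neighborFinset i, F j i :=
  Finset.sum_comm' (by simp [G.adj_comm])

/-- The disagreement `∑_i ∑_{j ∈ N_i} ‖z_j - z_i‖²` of a family of states. -/
def disagreement (z : Fin n → Vec d) : ℝ :=
  ∑ i, ∑ j ∈ G.neighborFinset i, ‖z j - z i‖ ^ 2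

theorem sum_inner_neighbor (z : Fin n → Vec d) :
    2 * ∑ i, inner ℝ (z i) (∑ j ∈ G.neighborFinset i, (z j - z i)) = - disagreement G z := by
  have h1 : disagreement G z
      = ∑ i, ∑ j ∈ G.neighborFinset i, inner ℝ (z j) (z j - z i)
        - ∑ i, ∑ j ∈ G.neighborFinset i, inner ℝ (z i) (z j - z i) := by
    simp only [disagreement, ← Finset.sum_sub_distrib, ← inner_sub_left, real_inner_self_eq_norm_sq]
  have h2 : ∑ i, ∑ j ∈ G.neighborFinset i, inner ℝ (z j) (z j - z i)
      = - ∑ i, ∑ j ∈ G.neighborFinset i, inner ℝ (z i) (z j - z i) := by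
    rw [sum_neighbor_comm]
    simp only [← Finset.sum_neg_distrib, ← inner_neg_right, neg_sub]
  simp only [inner_sum]
  linarith

/-- The mixing step `z_i ↦ z_i + η ∑_{j ∈ N_i} (z_j - z_i)` loses energy in proportion to the
disagreement. -/
theorem sum_norm_sq_mixing_le {η : ℝ} (z : Fin n → Vec d) :
    ∑ i, ‖z i + η • ∑ j ∈ G.neighborFinset i, (z j - z i)‖ ^ 2
      ≤ ∑ i, ‖z i‖ ^ 2 - η * (1 - η * n) * disagreement G z := by
  have h : ∀ i, ‖z i + η • ∑ j ∈ G.neighborFinset i, (z j - z i)‖ ^ 2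
      ≤ ‖z i‖ ^ 2 + η * (2 * inner ℝ (z i) (∑ j ∈ G.neighborFinset i, (z j - z i)))
        + η ^ 2 * n * ∑ j ∈ G.neighborFinset i, ‖z j - z i‖ ^ 2 := by
    intro i
    rw [norm_add_sq_real, inner_smul_right, norm_smul, mul_pow, Real.norm_eq_abs, sq_abs]
    have hle : ‖∑ j ∈ G.neighborFinset i, (z j - z i)‖ ^ 2
        ≤ n * ∑ j ∈ G.neighborFinset i, ‖z j - z i‖ ^ 2 := by
      calc ‖∑ j ∈ G.neighborFinset i, (z j - z i)‖ ^ 2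
          ≤ (∑ j ∈ G.neighborFinset i, ‖z j - z i‖) ^ 2 := by
            gcongr; exact norm_sum_le _ _
        _ ≤ (G.neighborFinset i).card * ∑ j ∈ G.neighborFinset i, ‖z j - z i‖ ^ 2 :=
            sq_sum_le_card_mul_sum_sq
        _ ≤ n * ∑ j ∈ G.neighborFinset i, ‖z j - z i‖ ^ 2 := by
            gcongr
            exact (Finset.card_le_univ _).trans_eq (Fintype.card_fin n)
    nlinarith [mul_le_mul_of_nonneg_left hle (sq_nonneg η)]
  refine (Finset.sum_le_sum fun i _ => h i).trans (le_of_eq ?_)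
  rw [Finset.sum_add_distrib, Finset.sum_add_distrib, ← Finset.mul_sum, ← Finset.mul_sum,
    ← Finset.mul_sum, sum_inner_neighbor]
  simp only [disagreement]
  ring

theorem eq_of_disagreement_nonpos (hG : G.Connected) {z : Fin n → Vec d}
    (hz : disagreement G z ≤ 0) (i j : Fin n) : z i = z j := by
  have hadj : ∀ i j, G.Adj i j → z i = z j := by
    intro i j hij
    have h0 : disagreement G z = 0 :=
      le_antisymm hz (Finset.sum_nonneg fun i _ => Finset.sum_nonneg fun j _ => sq_nonneg _)
    rw [disagreement, Finset.sum_eq_zero_iff_of_nonneg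
      (fun i _ => Finset.sum_nonneg fun j _ => sq_nonneg _)] at h0
    have h1 := h0 i (Finset.mem_univ i)
    rw [Finset.sum_eq_zero_iff_of_nonneg (fun j _ => sq_nonneg _)] at h1
    have h2 := h1 j (by simpa using hij)
    rw [sq_eq_zero_iff, norm_eq_zero, sub_eq_zero] at h2
    exact h2.symm
  obtain ⟨w⟩ := hG.preconnected i j
  induction w with
  | nil => rfl
  | cons h _ ih => exact (hadj _ _ h).trans ih

/-- The linear part of one step of projection consensus, on the `ℓ²` sum of the state spaces of
the nodes: mixing, followed by the projection onto `V i` at each node `i`. -/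
def consensusStep (η : ℝ) (V : Fin n → Submodule ℝ (Vec d)) :
    PiLp 2 (fun _ : Fin n => Vec d) →ₗ[ℝ] PiLp 2 (fun _ : Fin n => Vec d) where
  toFun z := WithLp.toLp 2 fun i =>
    (V i).starProjection (z i + η • ∑ j ∈ G.neighborFinset i, (z j - z i))
  map_add' z w := by
    ext1 i
    simp only [PiLp.add_apply]
    rw [← map_add]
    congr 1
    rw [add_add_add_comm, ← smul_add, ← Finset.sum_add_distrib]
    simp only [add_sub_add_comm]
  map_smul' c z := by
    ext1 i
    simp only [PiLp.smul_apply, RingHom.id_apply]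
    rw [← map_smul]
    congr 1
    simp only [← smul_sub, ← Finset.smul_sum, smul_add]
    rw [smul_comm c η]

theorem consensusStep_apply (η : ℝ) (V : Fin n → Submodule ℝ (Vec d))
    (z : PiLp 2 (fun _ : Fin n => Vec d)) (i : Fin n) :
    consensusStep G η V z i
      = (V i).starProjection (z i + η • ∑ j ∈ G.neighborFinset i, (z j - z i)) := rfl

/-- The families of states whose sum is orthogonal to `V`, i.e. the orthogonal complement of the
families `(v, …, v)` with `v ∈ V`. -/
def sumOrthogonal (n : ℕ) {d : ℕ} (V : Submodule ℝ (Vec d)) :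
    Submodule ℝ (PiLp 2 (fun _ : Fin n => Vec d)) where
  carrier := {z | ∀ v ∈ V, inner ℝ (∑ i, z i) v = 0}
  add_mem' {z w} hz hw v hv := by
    simp [PiLp.add_apply, Finset.sum_add_distrib, inner_add_left, hz v hv, hw v hv]
  zero_mem' v _ := by simp
  smul_mem' c z hz v hv := by
    simp [PiLp.smul_apply, ← Finset.smul_sum, inner_smul_left, hz v hv]

theorem consensusStep_mem {η : ℝ} {V : Fin n → Submodule ℝ (Vec d)}
    {z : PiLp 2 (fun _ : Fin n => Vec d)} (hz : z ∈ sumOrthogonal n (⨅ i, V i)) :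
    consensusStep G η V z ∈ sumOrthogonal n (⨅ i, V i) := by
  intro v hv
  have h1 : ∀ i, inner ℝ (consensusStep G η V z i) v
      = inner ℝ (z i + η • ∑ j ∈ G.neighborFinset i, (z j - z i)) v := by
    intro i
    rw [consensusStep_apply, Submodule.inner_starProjection_left_eq_right,
      Submodule.starProjection_eq_self_iff.2 ((Submodule.mem_iInf _).1 hv i)]
  have h2 : ∑ i, ∑ j ∈ G.neighborFinset i, (z j - z i) = 0 := by
    simp only [Finset.sum_sub_distrib]
    rw [sum_neighbor_comm G (fun _ j => z j), sub_self]
  rw [sum_inner, Finset.sum_congr rfl fun i _ => h1 i, ← sum_inner, Finset.sum_add_distrib,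
    ← Finset.smul_sum, h2, smul_zero, add_zero]
  exact hz v hv

/-- If neither mixing nor projecting loses energy, then all states agree and lie in every `V i`;
the only such family which is orthogonal to these is zero. -/
theorem norm_consensusStep_lt (hG : G.Connected) {η : ℝ} (hη₀ : 0 < η) (hη₁ : η < 1 / (n : ℝ))
    {V : Fin n → Submodule ℝ (Vec d)} {z : PiLp 2 (fun _ : Fin n => Vec d)}
    (hz : z ∈ sumOrthogonal n (⨅ i, V i)) (h0 : z ≠ 0) : ‖consensusStep G η V z‖ < ‖z‖ := by
  obtain ⟨i₀⟩ := hG.nonempty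
  have hn : (0 : ℝ) < n := Nat.cast_pos.2 (Fin.pos i₀)
  by_contra hlt
  rw [not_lt] at hlt
  apply h0
  have hsq : ∑ i, ‖z i‖ ^ 2 ≤ ∑ i, ‖consensusStep G η V z i‖ ^ 2 := by
    rw [← PiLp.norm_sq_eq_of_L2, ← PiLp.norm_sq_eq_of_L2]
    gcongr
  have hproj : ∀ i, ‖consensusStep G η V z i‖ ^ 2
      ≤ ‖z i + η • ∑ j ∈ G.neighborFinset i, (z j - z i)‖ ^ 2 := by
    intro i
    rw [consensusStep_apply]
    gcongr
    exact Submodule.norm_starProjection_apply_le _ _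
  have hmix := sum_norm_sq_mixing_le G (η := η) z
  have hpos : 0 < η * (1 - η * n) := by
    rw [lt_div_iff₀ hn] at hη₁
    exact mul_pos hη₀ (by linarith)
  have hsum := Finset.sum_le_sum fun i (_ : i ∈ Finset.univ) => hproj i
  have hdis : disagreement G z ≤ 0 := by
    by_contra hd
    nlinarith [mul_pos hpos (not_le.1 hd)]
  have heq := eq_of_disagreement_nonpos G hG hdis
  have hfix : ∀ i, z i + η • ∑ j ∈ G.neighborFinset i, (z j - z i) = z i := by
    intro i
    rw [Finset.sum_eq_zero fun j _ => by rw [heq j i, sub_self], smul_zero, add_zero]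
  have hmem : ∀ i, z i ∈ V i := by
    have hall := (Finset.sum_eq_sum_iff_of_le fun i (_ : i ∈ Finset.univ) => hproj i).1
      (le_antisymm hsum (by simpa only [hfix] using hsq))
    intro i
    have hi := hall i (Finset.mem_univ i)
    rw [consensusStep_apply, hfix] at hi
    exact (Submodule.mem_iff_norm_starProjection _ _).2 ((sq_eq_sq₀ (norm_nonneg _)
      (norm_nonneg _)).1 hi)
  have hV : z i₀ ∈ ⨅ i, V i := (Submodule.mem_iInf _).2 fun i => heq i i₀ ▸ hmem i
  have hs := hz _ hV
  rw [Finset.sum_congr rfl fun i _ => heq i i₀, Finset.sum_const, Finset.card_univ,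
    Fintype.card_fin, ← Nat.cast_smul_eq_nsmul ℝ, inner_smul_left,
    real_inner_self_eq_norm_sq] at hs
  have hz0 : z i₀ = 0 := by simpa [hn.ne'] using hs
  ext1 i
  rw [heq i i₀, hz0]
  rfl

/-- The distance from the state to a common point `c` of all affine subspaces evolves linearly. -/
theorem consensus_sub {η : ℝ} {A : Fin n → AffineSubspace ℝ (Vec d)} {c : Vec d}
    (hc : ∀ i, c ∈ A i) (x₀ : Fin n → Vec d) (t : ℕ) :
    WithLp.toLp 2 (fun i => consensus G η A x₀ t i - c)
      = ((consensusStep G η fun i => (A i).direction) ^ t)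
        (WithLp.toLp 2 fun i => x₀ i - c) := by
  induction t with
  | zero => rfl
  | succ t ih =>
    rw [pow_succ', Module.End.mul_apply, ← ih]
    ext1 i
    rw [consensusStep_apply]
    simp only [consensus, affineProj_eq (hc i), add_sub_cancel_left, sub_sub_sub_cancel_right]
    rw [add_sub_right_comm]

theorem norm_consensusStep_pow_le {η ρ : ℝ} {V : Fin n → Submodule ℝ (Vec d)} (hρ : 0 ≤ ρ)
    (h : ∀ z ∈ sumOrthogonal n (⨅ i, V i), ‖consensusStep G η V z‖ ≤ ρ * ‖z‖)
    {z : PiLp 2 (fun _ : Fin n => Vec d)} (hz : z ∈ sumOrthogonal n (⨅ i, V i)) (t : ℕ) :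
    ‖(consensusStep G η V ^ t) z‖ ≤ ρ ^ t * ‖z‖ := by
  have hmem : ∀ t : ℕ, (consensusStep G η V ^ t) z ∈ sumOrthogonal n (⨅ i, V i) := by
    intro t
    induction t with
    | zero => exact hz
    | succ t ih =>
      rw [pow_succ', Module.End.mul_apply]
      exact consensusStep_mem G ih
  induction t with
  | zero => simp
  | succ t ih =>
    rw [pow_succ', Module.End.mul_apply]
    calc _ ≤ ρ * ‖(consensusStep G η V ^ t) z‖ := h _ (hmem t)
      _ ≤ ρ * (ρ ^ t * ‖z‖) := by gcongr
      _ = ρ ^ (t + 1) * ‖z‖ := by ring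

end Step

/-! ### Exponential convergence to the exact output -/

section Convergence

variable {n m : ℕ} (G : SimpleGraph (Fin n)) [DecidableRel G.Adj]

theorem delta_mem_nodeSpace {m : ℕ} (g : Assign m → Fin 2) (b : Fin 2) (j : Fin (2 ^ m)) :
    delta (2 ^ m) j ∈ nodeSpace g b ↔ g ((index m).symm j) = b := by
  change (booleanMatrix g).toEuclideanLin (delta (2 ^ m) j) = delta 2 b ↔ _
  have h : (booleanMatrix g).toEuclideanLin (delta (2 ^ m) j)
      = delta 2 (g ((index m).symm j)) := by
    ext r
    simp [delta, booleanMatrix, Matrix.toLpLin_apply]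
  rw [h]
  constructor
  · intro h
    by_contra hne
    have := congrArg (fun v : Vec 2 => v b) h
    simp [delta, Ne.symm hne] at this
  · rintro rfl
    rfl

theorem delta_mem_networkSpace (f : Fin n → Assign m → Fin 2) (σ : Fin n → Fin 2)
    (j : Fin (2 ^ m)) :
    delta (2 ^ m) j ∈ networkSpace f σ ↔ (index m).symm j ∈ solutionSet f σ := by
  simp only [networkSpace, AffineSubspace.mem_iInf_iff, delta_mem_nodeSpace, solutionSet,
    Set.mem_ofPred_eq]

theorem networkSpace_nonempty {f : Fin n → Assign m → Fin 2} {σ : Fin n → Fin 2}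
    (hsat : (solutionSet f σ).Nonempty) :
    (networkSpace f σ : Set (Vec (2 ^ m))).Nonempty := by
  obtain ⟨x, hx⟩ := hsat
  exact ⟨delta (2 ^ m) (index m x), (delta_mem_networkSpace f σ _).2 (by simpa using hx)⟩

/-- The residual is the orbit of its initial value under `consensusStep`. That value lies in the
subspace on which the step contracts, because the exact output has the same sum of projections onto
the network space as the initial values. -/
theorem exists_residualBound (hG : G.Connected) {η : ℝ} (hη₀ : 0 < η) (hη₁ : η < 1 / (n : ℝ))
    {f : Fin n → Assign m → Fin 2} {σ : Fin n → Fin 2} (hsat : (solutionSet f σ).Nonempty) :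
    ∃ C₀ > 0, ∃ γ₀ > 0, ResidualBound G η f σ C₀ γ₀ := by
  obtain ⟨i₀⟩ := hG.nonempty
  have hn : n ≠ 0 := (Fin.pos i₀).ne'
  obtain ⟨p, hp⟩ := networkSpace_nonempty hsat
  set V : Fin n → Submodule ℝ (Vec (2 ^ m)) := fun i => (nodeSpace (f i) (σ i)).direction with hV
  have hdir : (networkSpace f σ).direction = ⨅ i, V i :=
    AffineSubspace.direction_iInf_of_mem_iInf _ p hp
  obtain ⟨ρ, hρ0, hρ1, hρ⟩ := exists_contraction_factor (consensusStep G η V)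
    (sumOrthogonal n (⨅ i, V i)) fun z hz h0 => norm_consensusStep_lt G hG hη₀ hη₁ hz h0
  set B : ℝ := 2 * (Real.sqrt ((2 ^ m : ℕ) : ℝ) + ‖p‖) with hB
  refine ⟨Real.sqrt (n * B ^ 2) + 1, by positivity, -Real.log ρ,
    neg_pos.2 (Real.log_neg hρ0 hρ1), ?_⟩
  intro x₀ hx₀ T i
  set c := exactLimit f σ x₀ with hc
  have hcE : c = affineProj (networkSpace f σ) ((n : ℝ)⁻¹ • ∑ k, x₀ k) :=
    average_affineProj hn ⟨p, hp⟩ x₀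
  have hcmem : ∀ i, c ∈ nodeSpace (f i) (σ i) := by
    have := affineProj_mem ⟨p, hp⟩ ((n : ℝ)⁻¹ • ∑ k, x₀ k)
    rw [← hcE] at this
    exact (AffineSubspace.mem_iInf_iff _ _).1 this
  set e₀ : PiLp 2 (fun _ : Fin n => Vec (2 ^ m)) := WithLp.toLp 2 fun i => x₀ i - c with he₀
  have hmem : e₀ ∈ sumOrthogonal n (⨅ i, V i) := by
    intro v hv
    rw [← hdir] at hv
    have hsum : ∑ i, e₀ i = ∑ i, (x₀ i - affineProj (networkSpace f σ) (x₀ i)) := by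
      have : (n : ℝ) • c = ∑ k, affineProj (networkSpace f σ) (x₀ k) := by
        rw [hc, exactLimit, smul_smul, mul_inv_cancel₀ (Nat.cast_ne_zero.2 hn), one_smul]
      simp only [he₀, Finset.sum_sub_distrib, Finset.sum_const, Finset.card_univ,
        Fintype.card_fin, ← this, ← Nat.cast_smul_eq_nsmul ℝ]
    rw [hsum, sum_inner]
    refine Finset.sum_eq_zero fun i _ => ?_
    rw [affineProj_eq hp, ← sub_sub]
    exact Submodule.starProjection_inner_eq_zero _ _ hv
  have hxp : ∀ k, ‖x₀ k - p‖ ≤ Real.sqrt ((2 ^ m : ℕ) : ℝ) + ‖p‖ := fun k =>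
    (norm_sub_le _ _).trans (by gcongr; exact norm_le_of_mem_cube (hx₀ k))
  have hcp : ‖c - p‖ ≤ Real.sqrt ((2 ^ m : ℕ) : ℝ) + ‖p‖ := by
    have h1 : c - p = (n : ℝ)⁻¹ • ∑ k, (networkSpace f σ).direction.starProjection (x₀ k - p) := by
      simp only [hc, exactLimit, affineProj_eq hp]
      rw [Finset.sum_add_distrib, smul_add, Finset.sum_const, Finset.card_univ, Fintype.card_fin,
        ← Nat.cast_smul_eq_nsmul ℝ, smul_smul, inv_mul_cancel₀ (Nat.cast_ne_zero.2 hn), one_smul,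
        add_sub_cancel_left]
    rw [h1, norm_smul, norm_inv, Real.norm_natCast,
      inv_mul_le_iff₀ (Nat.cast_pos.2 (Nat.pos_of_ne_zero hn))]
    calc _ ≤ ∑ k : Fin n, (Real.sqrt ((2 ^ m : ℕ) : ℝ) + ‖p‖) :=
          norm_sum_le_of_le _ fun k _ =>
            (Submodule.norm_starProjection_apply_le _ _).trans (hxp k)
      _ = n * (Real.sqrt ((2 ^ m : ℕ) : ℝ) + ‖p‖) := by simp [mul_add]
  have hnorm : ‖e₀‖ ≤ Real.sqrt (n * B ^ 2) := by
    refine Real.le_sqrt_of_sq_le ?_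
    rw [PiLp.norm_sq_eq_of_L2]
    calc ∑ k, ‖e₀ k‖ ^ 2 ≤ ∑ _k : Fin n, B ^ 2 := by
          refine Finset.sum_le_sum fun k _ => ?_
          gcongr
          calc ‖e₀ k‖ = ‖(x₀ k - p) - (c - p)‖ := by simp [he₀]
            _ ≤ _ := (norm_sub_le _ _).trans (by linarith [hxp k])
      _ = n * B ^ 2 := by simp
  have hexp : Real.exp (-(-Real.log ρ) * T) = ρ ^ T := by
    rw [neg_neg, mul_comm, Real.exp_nat_mul, Real.exp_log hρ0]
  rw [hexp]
  calc ‖nodeState G η f σ x₀ T i - c‖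
      ≤ ‖(WithLp.toLp 2 (fun i => nodeState G η f σ x₀ T i - c) :
          PiLp 2 (fun _ : Fin n => Vec (2 ^ m)))‖ :=
        PiLp.norm_apply_le (WithLp.toLp 2 (fun i => nodeState G η f σ x₀ T i - c) :
          PiLp 2 (fun _ : Fin n => Vec (2 ^ m))) i
    _ = ‖(consensusStep G η V ^ T) e₀‖ := by
        simp only [nodeState]
        rw [consensus_sub G hcmem]
    _ ≤ ρ ^ T * ‖e₀‖ := norm_consensusStep_pow_le G hρ0.le hρ hmem T
    _ ≤ (Real.sqrt (n * B ^ 2) + 1) * ρ ^ T := by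
        rw [mul_comm]
        gcongr
        linarith

end Convergence

/-! ### Affine subspaces close to the projections of affinely independent points -/

section Perturbation

variable {d : ℕ}

/-- The matrix whose rows are the differences `u_{s+1} - u_0`. -/
def edgeMatrix (u : Fin (d + 1) → Vec d) : Matrix (Fin d) (Fin d) ℝ :=
  Matrix.of fun s j => (u s.succ - u 0) j

/-- The sum of the absolute values of the entries of the inverse edge matrix. -/
def inverseSize (u : Fin (d + 1) → Vec d) : ℝ :=
  ∑ s, ∑ j, |(edgeMatrix u)⁻¹ j s|

theorem inverseSize_nonneg (u : Fin (d + 1) → Vec d) : 0 ≤ inverseSize u :=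
  Finset.sum_nonneg fun _ _ => Finset.sum_nonneg fun _ _ => abs_nonneg _

/-- The coordinates of a vector in the basis of the edges `u_{s+1} - u_0`. -/
def edgeCoords (u : Fin (d + 1) → Vec d) : Vec d →ₗ[ℝ] (Fin d → ℝ) :=
  (edgeMatrix u)⁻¹.vecMulLinear ∘ₗ (WithLp.linearEquiv 2 ℝ (Fin d → ℝ)).toLinearMap

theorem edgeCoords_apply (u : Fin (d + 1) → Vec d) (x : Vec d) (s : Fin d) :
    edgeCoords u x s = ∑ j, x j * (edgeMatrix u)⁻¹ j s := rfl

theorem sum_edgeCoords_smul {u : Fin (d + 1) → Vec d} (hu : (edgeMatrix u).det ≠ 0) (x : Vec d) :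
    ∑ s, edgeCoords u x s • (u s.succ - u 0) = x := by
  have h : Matrix.vecMul (edgeCoords u x) (edgeMatrix u) = x := by
    change Matrix.vecMul (Matrix.vecMul x.ofLp (edgeMatrix u)⁻¹) (edgeMatrix u) = x
    rw [Matrix.vecMul_vecMul, Matrix.nonsing_inv_mul _ hu.isUnit, Matrix.vecMul_one]
  ext j
  rw [← congrFun h j]
  simp [Matrix.vecMul, dotProduct, edgeMatrix]

theorem sum_abs_edgeCoords_le (u : Fin (d + 1) → Vec d) (x : Vec d) :
    ∑ s, |edgeCoords u x s| ≤ inverseSize u * ‖x‖ := by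
  rw [inverseSize, Finset.sum_mul]
  refine Finset.sum_le_sum fun s _ => ?_
  rw [edgeCoords_apply, Finset.sum_mul]
  refine (Finset.abs_sum_le_sum_abs _ _).trans (Finset.sum_le_sum fun j _ => ?_)
  rw [abs_mul, mul_comm]
  gcongr
  exact PiLp.norm_apply_le x j

/-- If an affine map differs by at most `ε` from the projection `P_E` at the points `u_s`, then
`ε * amplification E u`, when less than `1`, bounds the distance to `E` of those values of the map
on `E` that lie in the unit ball. -/
def amplification (E : AffineSubspace ℝ (Vec d)) (u : Fin (d + 1) → Vec d) : ℝ :=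
  1 + 4 * inverseSize u * (2 + ‖affineProj E (u 0)‖)

/-- An affine subspace `A` which passes close to the projections onto `E` of affinely independent
points `u_s` has at least the dimension of `E`, and if the dimensions agree, then the points of `A`
in the unit ball are close to `E`. Indeed, the affine map which sends `u_s` to a point of `A`
near `P_E (u_s)` takes values in `A` and is a small perturbation of `P_E`, so it is injective on
`E`. -/
theorem finrank_le_and_exists_near {E A : AffineSubspace ℝ (Vec d)}
    (hE : (E : Set (Vec d)).Nonempty) {u : Fin (d + 1) → Vec d} (hu : (edgeMatrix u).det ≠ 0)
    {z : Fin (d + 1) → Vec d} (hzA : ∀ s, z s ∈ A) {ε r : ℝ}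
    (hz : ∀ s, ‖z s - affineProj E (u s)‖ ≤ ε) (hr : r ≤ 1) (hε : ε * amplification E u < r) :
    Module.finrank ℝ E.direction ≤ Module.finrank ℝ A.direction ∧
      (Module.finrank ℝ A.direction ≤ Module.finrank ℝ E.direction →
        ∀ q ∈ A, ‖q‖ ≤ 1 → ∃ e ∈ E, ‖q - e‖ < r) := by
  obtain ⟨p, hp⟩ := hE
  have hε0 : 0 ≤ ε := (norm_nonneg _).trans (hz 0)
  have hN := inverseSize_nonneg u
  set N := inverseSize u
  set R := ‖affineProj E (u 0)‖ with hR
  have hR0 : 0 ≤ R := norm_nonneg _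
  have hamp : amplification E u = 1 + 4 * N * (2 + R) := rfl
  have hNR : 0 ≤ N * R := mul_nonneg hN hR0
  have hεN : 0 ≤ ε * N := mul_nonneg hε0 hN
  have hεNR : 0 ≤ ε * (N * R) := mul_nonneg hε0 hNR
  have hκ : 2 * ε * N ≤ 1 / 4 := by
    rw [hamp] at hε
    linarith
  have hε1 : ε ≤ 1 := by
    rw [hamp] at hε
    linarith
  -- The linear part of the difference between the perturbed map and the projection onto `E`.
  set Ψ : Vec d →ₗ[ℝ] Vec d :=
    (Fintype.linearCombination ℝ fun s : Fin d =>
      (z s.succ - affineProj E (u s.succ)) - (z 0 - affineProj E (u 0))) ∘ₗ edgeCoords u with hΨdef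
  have hΨapp : ∀ x, Ψ x = ∑ s : Fin d, edgeCoords u x s •
      ((z s.succ - affineProj E (u s.succ)) - (z 0 - affineProj E (u 0))) := fun x => rfl
  have hΨ : ∀ x, ‖Ψ x‖ ≤ 2 * ε * N * ‖x‖ := by
    intro x
    rw [hΨapp]
    calc _ ≤ ∑ s : Fin d, |edgeCoords u x s| * (2 * ε) := by
          refine norm_sum_le_of_le _ fun s _ => ?_
          rw [norm_smul, Real.norm_eq_abs]
          gcongr
          exact (norm_sub_le _ _).trans (by linarith [hz s.succ, hz 0])
      _ ≤ (N * ‖x‖) * (2 * ε) := by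
          rw [← Finset.sum_mul]
          gcongr
          exact sum_abs_edgeCoords_le u x
      _ = _ := by ring
  have hmem : ∀ x ∈ E.direction, x + Ψ x ∈ A.direction := by
    intro x hx
    have h1 : x = ∑ s : Fin d, edgeCoords u x s •
        (affineProj E (u s.succ) - affineProj E (u 0)) := by
      conv_lhs => rw [← Submodule.starProjection_eq_self_iff.2 hx, ← sum_edgeCoords_smul hu x]
      rw [map_sum]
      refine Finset.sum_congr rfl fun s _ => ?_
      rw [map_smul, affineProj_eq hp, affineProj_eq hp, add_sub_add_left_eq_sub, ← map_sub,
        sub_sub_sub_cancel_right]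
    have h2 : x + Ψ x = ∑ s : Fin d, edgeCoords u x s • (z s.succ - z 0) := by
      conv_lhs => rw [hΨapp]; enter [1]; rw [h1]
      rw [← Finset.sum_add_distrib]
      refine Finset.sum_congr rfl fun s _ => ?_
      rw [← smul_add]
      congr 1
      abel
    rw [h2]
    exact Submodule.sum_mem _ fun s _ => Submodule.smul_mem _ _
      (AffineSubspace.vsub_mem_direction (hzA _) (hzA _))
  set Φ : E.direction →ₗ[ℝ] A.direction :=
    ((LinearMap.id + Ψ) ∘ₗ E.direction.subtype).codRestrict A.direction
      (fun x => hmem x x.2) with hΦ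
  have hΦapp : ∀ x : E.direction, (Φ x : Vec d) = x + Ψ x := fun x => rfl
  have hinj : Function.Injective Φ := by
    rw [injective_iff_map_eq_zero]
    intro x hx
    have h0 : (x : Vec d) + Ψ x = 0 := by rw [← hΦapp, hx]; rfl
    have h1 : ‖(x : Vec d)‖ = ‖Ψ x‖ := by
      conv_lhs => rw [eq_neg_of_add_eq_zero_left h0, norm_neg]
    have h2 := hΨ x
    have h3 : 2 * ε * N * ‖(x : Vec d)‖ ≤ 1 / 4 * ‖(x : Vec d)‖ := by gcongr
    have h4 : ‖(x : Vec d)‖ = 0 := le_antisymm (by linarith) (norm_nonneg _)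
    exact Subtype.ext (norm_eq_zero.1 h4)
  refine ⟨LinearMap.finrank_le_finrank_of_injective hinj, fun hle q hq hq1 => ?_⟩
  have hsurj : Function.Surjective Φ :=
    (LinearMap.injective_iff_surjective_of_finrank_eq_finrank
      ((LinearMap.finrank_le_finrank_of_injective hinj).antisymm hle)).1 hinj
  obtain ⟨x, hx⟩ := hsurj ⟨q - z 0, AffineSubspace.vsub_mem_direction hq (hzA 0)⟩
  have hx' : (x : Vec d) + Ψ x = q - z 0 := by rw [← hΦapp, hx]
  refine ⟨x + affineProj E (u 0),
    AffineSubspace.vadd_mem_of_mem_direction x.2 (affineProj_mem ⟨p, hp⟩ _), ?_⟩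
  have hz0 : ‖z 0‖ ≤ ε + R := by
    calc ‖z 0‖ = ‖(z 0 - affineProj E (u 0)) + affineProj E (u 0)‖ := by rw [sub_add_cancel]
      _ ≤ _ := (norm_add_le _ _).trans (by linarith [hz 0])
  have hxn : ‖(x : Vec d)‖ ≤ 2 * (2 + R) := by
    have h1 : ‖(x : Vec d)‖ ≤ ‖q‖ + ‖z 0‖ + ‖Ψ x‖ := by
      conv_lhs => rw [eq_sub_of_add_eq hx']
      exact (norm_sub_le _ _).trans (by gcongr; exact norm_sub_le _ _)
    have h2 := hΨ x
    have h3 : 2 * ε * N * ‖(x : Vec d)‖ ≤ 1 / 4 * ‖(x : Vec d)‖ := by gcongr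
    linarith [norm_nonneg (x : Vec d)]
  have hdiff : q - ((x : Vec d) + affineProj E (u 0)) = (z 0 - affineProj E (u 0)) + Ψ x := by
    rw [eq_add_of_sub_eq hx'.symm]
    abel
  calc ‖q - ((x : Vec d) + affineProj E (u 0))‖ ≤ ε + 2 * ε * N * ‖(x : Vec d)‖ := by
        rw [hdiff]
        exact (norm_add_le _ _).trans (add_le_add (hz 0) (hΨ x))
    _ ≤ ε + 2 * ε * N * (2 * (2 + R)) := by gcongr
    _ = ε * amplification E u := by rw [hamp]; ring
    _ < r := hε

end Perturbation

/-! ### The outputs for affinely independent averages of the initial values -/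

section Outputs

variable {n m : ℕ} (G : SimpleGraph (Fin n)) [DecidableRel G.Adj]

theorem norm_delta {c : ℕ} (i : Fin c) : ‖delta c i‖ = 1 := by
  simp [delta]

/-- The finitely many Boolean vectors outside of an affine subspace keep a distance from it. -/
theorem exists_booleanVectors_gap {d : ℕ} {E : AffineSubspace ℝ (Vec d)}
    (hE : (E : Set (Vec d)).Nonempty) :
    ∃ r : ℝ, 0 < r ∧ r ≤ 1 ∧ ∀ j, delta d j ∉ E → ∀ e ∈ E, r ≤ ‖delta d j - e‖ := by
  have h : ∀ j, ∃ r : ℝ, 0 < r ∧ (delta d j ∉ E → ∀ e ∈ E, r ≤ ‖delta d j - e‖) := by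
    intro j
    by_cases hj : delta d j ∈ E
    · exact ⟨1, one_pos, fun h => absurd hj h⟩
    · refine ⟨Metric.infDist (delta d j) E, ?_, fun _ e he => ?_⟩
      · exact (IsClosed.notMem_iff_infDist_pos E.closed_of_finiteDimensional hE).1 hj
      · rw [← dist_eq_norm]
        exact Metric.infDist_le_dist_of_mem he
  choose r hr0 hr using h
  obtain ⟨b, hb0, hb⟩ : ∃ b : ℝ, 0 < b ∧ ∀ j, b ≤ r j := by
    rcases isEmpty_or_nonempty (Fin d) with hd | hd
    · exact ⟨1, one_pos, fun j => (hd.false j).elim⟩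
    · obtain ⟨j, hj⟩ := Finite.exists_min r
      exact ⟨r j, hr0 j, hj⟩
  exact ⟨min b 1, lt_min hb0 one_pos, min_le_right _ _, fun j hj e he =>
    (min_le_left _ _).trans ((hb j).trans (hr j hj e he))⟩

theorem upsilonImage_booleanPart_networkSpace (f : Fin n → Assign m → Fin 2) (σ : Fin n → Fin 2) :
    upsilonImage m (booleanPart (networkSpace f σ)) = solutionSet f σ := by
  ext x
  constructor
  · rintro ⟨j, hj, rfl⟩
    exact (delta_mem_networkSpace f σ j).1 hj.1
  · intro hx
    refine ⟨index m x, ⟨?_, Set.mem_range_self _⟩, by simp⟩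
    exact (delta_mem_networkSpace f σ _).2 (by simpa using hx)

/-- The averages over the nodes of the initial values of the `2^m + 1` runs. -/
def averages {n N d : ℕ} (b : Fin n → Fin N → Vec d) (s : Fin N) : Vec d :=
  (n : ℝ)⁻¹ • ∑ k, b k s

/-- Once the tolerance is small in comparison with the amplification, the network space is optimal
and every optimal space contains the same Boolean vectors. The factor `2` adds the distance from
the state to the exact output to the distance from the state to a feasible space. -/
theorem outputs_eq_singleton (hn : n ≠ 0) {η : ℝ} {f : Fin n → Assign m → Fin 2}
    {σ : Fin n → Fin 2} (hsat : (solutionSet f σ).Nonempty) {C₀ γ₀ Cs γs : ℝ}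
    (hC₀ : 0 < C₀) (hres : ResidualBound G η f σ C₀ γ₀) (hCs : C₀ ≤ Cs) (hγs : γs ≤ γ₀)
    {r : ℝ} (hr1 : r ≤ 1)
    (hr : ∀ j, delta (2 ^ m) j ∉ networkSpace f σ →
      ∀ e ∈ networkSpace f σ, r ≤ ‖delta (2 ^ m) j - e‖)
    {b : Fin n → Fin (2 ^ m + 1) → Vec (2 ^ m)} (hb : ∀ k s, b k s ∈ cube (2 ^ m))
    (hdet : (edgeMatrix (averages b)).det ≠ 0) {T : ℕ}
    (hT : 2 * tolerance m Cs γs T * amplification (networkSpace f σ) (averages b) < r)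
    (i : Fin n) :
    outputs G η f σ Cs γs b T i = {solutionSet f σ} := by
  have hE := networkSpace_nonempty hsat
  set E := networkSpace f σ with hEdef
  set y : Fin (2 ^ m + 1) → Vec (2 ^ m) :=
    fun s => nodeState G η f σ (fun k => b k s) T i with hy
  set ε := tolerance m Cs γs T with hε
  set τ : ℝ := Cs * Real.exp (-γs * T) with hτ
  have hτ0 : 0 ≤ τ := mul_nonneg (hC₀.le.trans hCs) (Real.exp_pos _).le
  have hετ : ε = τ * (2 ^ m + 1) := rfl
  have hτε : τ ≤ ε := by
    rw [hετ]
    exact le_mul_of_one_le_right hτ0 (by linarith [pow_pos (two_pos (α := ℝ)) m])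
  have hyE : ∀ s, ‖y s - affineProj E (averages b s)‖ ≤ τ := by
    intro s
    have h := hres (fun k => b k s) (fun k => hb k s) T i
    rw [exactLimit, average_affineProj hn hE] at h
    have hCs0 : 0 ≤ Cs := hC₀.le.trans hCs
    refine h.trans ?_
    rw [hτ]
    gcongr
  have hEfeas : Feasible y ε E := by
    refine ⟨hE, ?_⟩
    calc ∑ s, Metric.infDist (y s) (E : Set (Vec (2 ^ m))) ≤ ∑ _s : Fin (2 ^ m + 1), τ := by
          refine Finset.sum_le_sum fun s _ => ?_
          refine (Metric.infDist_le_dist_of_mem (affineProj_mem hE (averages b s))).trans ?_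
          rw [dist_eq_norm]
          exact hyE s
      _ = ε := by
          rw [hετ]
          simp [mul_comm]
  have hfeas : ∀ A, Feasible y ε A →
      Module.finrank ℝ E.direction ≤ Module.finrank ℝ A.direction ∧
      (Module.finrank ℝ A.direction ≤ Module.finrank ℝ E.direction →
        ∀ q ∈ A, ‖q‖ ≤ 1 → ∃ e ∈ E, ‖q - e‖ < r) := by
    intro A hA
    refine finrank_le_and_exists_near hE hdet (z := fun s => affineProj A (y s))
      (fun s => affineProj_mem hA.1 _) (fun s => ?_) hr1 hT
    have h1 : ‖affineProj A (y s) - y s‖ ≤ ε := by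
      rw [dist_affineProj hA.1]
      exact (Finset.single_le_sum (f := fun s => Metric.infDist (y s) (A : Set (Vec (2 ^ m))))
        (fun s _ => Metric.infDist_nonneg) (Finset.mem_univ s)).trans hA.2
    calc _ ≤ ‖affineProj A (y s) - y s‖ + ‖y s - affineProj E (averages b s)‖ :=
          norm_sub_le_norm_sub_add_norm_sub _ _ _
      _ ≤ 2 * ε := by linarith [hyE s]
  have hEmin : MinimalDim y ε E := ⟨hEfeas, fun B hB => (hfeas B hB).1⟩
  have hsub : ∀ A, MinimalDim y ε A → booleanPart A ⊆ booleanPart E := by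
    rintro A hA _ ⟨hqA, j, rfl⟩
    refine ⟨?_, j, rfl⟩
    by_contra hj
    obtain ⟨e, he, hlt⟩ := (hfeas A hA.1).2 (hA.2 E hEfeas) _ hqA (norm_delta j).le
    exact (hr j hj e he).not_gt hlt
  have hfin : (booleanPart E).Finite := (Set.finite_range _).subset Set.inter_subset_right
  have hEopt : Optimal y ε E := ⟨hEmin, fun B hB => Set.ncard_le_ncard (hsub B hB) hfin⟩
  ext S
  constructor
  · rintro ⟨A, hA, rfl⟩
    rw [Set.mem_singleton_iff,
      Set.eq_of_subset_of_ncard_le (hsub A hA.1) (hA.2 E hEmin) hfin]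
    exact upsilonImage_booleanPart_networkSpace f σ
  · rintro rfl
    exact ⟨E, hEopt, (upsilonImage_booleanPart_networkSpace f σ).symm⟩

end Outputs

/-! ### Random initial values -/

section Random

theorem measurableSet_cube (d : ℕ) : MeasurableSet (cube d) := by
  have : cube d = ⋂ j, (fun x : Vec d => x j) ⁻¹' Set.Icc 0 1 := by
    ext x
    simp [cube]
  rw [this]
  exact MeasurableSet.iInter fun j => (by fun_prop : Measurable fun x : Vec d => x j)
    measurableSet_Icc

theorem volume_cube (d : ℕ) : volume (cube d) = 1 := by
  have : cube d = (WithLp.ofLp : Vec d → Fin d → ℝ) ⁻¹'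
      (Set.univ.pi fun _ => Set.Icc (0 : ℝ) 1) := by
    ext x
    simp only [cube, Set.mem_preimage, Set.mem_univ_pi, Set.mem_ofPred_eq]
  rw [this, (PiLp.volume_preserving_ofLp (Fin d)).measure_preimage
    (MeasurableSet.univ_pi fun _ => measurableSet_Icc).nullMeasurableSet, volume_pi,
    Measure.pi_pi]
  simp

theorem map_eq_restrict {d : ℕ} {Ω : Type*} [MeasurableSpace Ω] {P : Measure Ω}
    {X : Ω → Vec d} (hX : pdf.IsUniform X (cube d) P volume) :
    P.map X = volume.restrict (cube d) := by
  rw [hX, ProbabilityTheory.cond, volume_cube, inv_one, one_smul]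

variable {n d : ℕ}

theorem continuous_edgeMatrix : Continuous (edgeMatrix : (Fin (d + 1) → Vec d) → _) := by
  refine continuous_matrix fun s j => ?_
  simp only [edgeMatrix, Matrix.of_apply]
  fun_prop

theorem measurable_det_edgeMatrix :
    Measurable fun u : Fin (d + 1) → Vec d => (edgeMatrix u).det :=
  continuous_edgeMatrix.matrix_det.measurable

theorem measurable_averages {N : ℕ} : Measurable (averages : (Fin n → Fin N → Vec d) → _) := by
  refine measurable_pi_lambda _ fun s => ?_
  simp only [averages]
  fun_prop

theorem measurable_amplification (E : AffineSubspace ℝ (Vec d)) :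
    Measurable (amplification E) := by
  have hinv : ∀ j s, Measurable fun u : Fin (d + 1) → Vec d => (edgeMatrix u)⁻¹ j s := by
    intro j s
    simp only [Matrix.inv_def, Matrix.smul_apply, Ring.inverse_eq_inv', smul_eq_mul]
    refine measurable_det_edgeMatrix.inv.mul ?_
    exact (continuous_edgeMatrix.matrix_adjugate.matrix_elem j s).measurable
  have hproj := (continuous_affineProj E).measurable
  have hsize : Measurable (inverseSize : (Fin (d + 1) → Vec d) → ℝ) := by
    unfold inverseSize
    exact Finset.measurable_sum _ fun s _ => Finset.measurable_sum _ fun j _ => (hinv j s).abs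
  unfold amplification
  exact ((hsize.const_mul 4).mul
    ((hproj.comp (measurable_pi_apply 0)).norm.const_add 2)).const_add 1

/-- Along the direction in which the edge matrix of the averages grows by multiples of the identity
matrix, its determinant is a monic polynomial. -/
theorem ae_det_averages_ne_zero (hn : n ≠ 0) :
    ∀ᵐ w : Fin n × Fin (d + 1) → Vec d,
      (edgeMatrix (averages fun k s => w (k, s))).det ≠ 0 := by
  set w₀ : Fin n × Fin (d + 1) → Vec d := fun p => Fin.cases 0 (delta d) p.2 with hw₀
  have hmeas : MeasurableSet {w : Fin n × Fin (d + 1) → Vec d |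
      (edgeMatrix (averages fun k s => w (k, s))).det ≠ 0} := by
    have h : Measurable fun w : Fin n × Fin (d + 1) → Vec d =>
        (edgeMatrix (averages fun k s => w (k, s))).det :=
      measurable_det_edgeMatrix.comp (measurable_averages.comp (by fun_prop))
    exact (h (measurableSet_singleton 0)).compl
  refine ae_mem_of_ae_add_linearMap_mem (LinearMap.toSpanSingleton ℝ _ w₀) volume volume hmeas
    fun w => ?_
  set M := edgeMatrix (averages fun k s => w (k, s)) with hM
  have hedge : ∀ t : ℝ, edgeMatrix (averages fun k s => (w + t • w₀) (k, s))
      = Matrix.scalar (Fin d) t - -M := by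
    intro t
    have hn' : (n : ℝ) ≠ 0 := Nat.cast_ne_zero.2 hn
    ext s j
    simp only [hM, edgeMatrix, averages, hw₀, Matrix.of_apply, Matrix.sub_apply, Matrix.neg_apply,
      Pi.add_apply, Pi.smul_apply, Fin.cases_succ, Fin.cases_zero, smul_zero, add_zero,
      Finset.sum_add_distrib, Finset.sum_const, Finset.card_univ, Fintype.card_fin, smul_add,
      PiLp.sub_apply, PiLp.add_apply, PiLp.smul_apply, smul_eq_mul, nsmul_eq_mul, delta,
      Matrix.scalar_apply, Matrix.diagonal_apply]
    by_cases hsj : s = j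
    · subst hsj
      simp
      field_simp
      ring
    · simp [hsj, Ne.symm hsj]
  have hroots : {t : ℝ | (-M).charpoly.IsRoot t}.Finite :=
    Polynomial.finite_setOfPred_isRoot (Matrix.charpoly_monic _).ne_zero
  refine Filter.mem_of_superset (compl_mem_ae_iff.2 (hroots.measure_zero _)) fun t ht => ?_
  change (edgeMatrix (averages fun k s => (w + t • w₀) (k, s))).det ≠ 0
  rw [hedge, ← Matrix.eval_charpoly]
  exact ht

variable {Ω : Type*} [MeasurableSpace Ω] {P : Measure Ω}
  {β : Fin n → Fin (d + 1) → Ω → Vec d}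

theorem ae_mem_cube (hβ_meas : ∀ i s, Measurable (β i s))
    (hβ_unif : ∀ i s, pdf.IsUniform (β i s) (cube d) P volume) :
    ∀ᵐ ω ∂P, ∀ k s, β k s ω ∈ cube d := by
  rw [ae_all_iff]
  intro k
  rw [ae_all_iff]
  intro s
  refine ae_of_ae_map (hβ_meas k s).aemeasurable ?_
  rw [map_eq_restrict (hβ_unif k s)]
  exact ae_restrict_mem (measurableSet_cube d)

theorem ae_det_ne_zero (hn : n ≠ 0) (hβ_meas : ∀ i s, Measurable (β i s))
    (hβ_unif : ∀ i s, pdf.IsUniform (β i s) (cube d) P volume)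
    (hβ_indep : iIndepFun (fun p : Fin n × Fin (d + 1) => β p.1 p.2) P) :
    ∀ᵐ ω ∂P, (edgeMatrix (averages fun k s => β k s ω)).det ≠ 0 := by
  have hlaw : P.map (fun ω (p : Fin n × Fin (d + 1)) => β p.1 p.2 ω)
      = (volume : Measure (Fin n × Fin (d + 1) → Vec d)).restrict
        (Set.univ.pi fun _ => cube d) := by
    refine (hβ_indep.map_fun_eq_pi_map
      fun p : Fin n × Fin (d + 1) => (hβ_meas p.1 p.2).aemeasurable).trans ?_
    rw [volume_pi, Measure.restrict_pi_pi]
    congr 1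
    funext p
    exact map_eq_restrict (hβ_unif p.1 p.2)
  have hmeas : Measurable fun ω (p : Fin n × Fin (d + 1)) => β p.1 p.2 ω :=
    measurable_pi_lambda _ fun p => hβ_meas p.1 p.2
  refine ae_of_ae_map (p := fun w : Fin n × Fin (d + 1) → Vec d =>
    (edgeMatrix (averages fun k s => w (k, s))).det ≠ 0) hmeas.aemeasurable ?_
  rw [hlaw]
  exact ae_restrict_of_ae (ae_det_averages_ne_zero hn)

end Random

theorem tendsto_tolerance (m : ℕ) (Cs : ℝ) {γs : ℝ} (hγs : 0 < γs) :
    Tendsto (tolerance m Cs γs) atTop (𝓝 0) := by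
  have h : Tendsto (fun T : ℕ => Real.exp (-γs * T)) atTop (𝓝 0) :=
    Real.tendsto_exp_atBot.comp
      (tendsto_natCast_atTop_atTop.const_mul_atTop_of_neg (neg_neg_of_pos hγs))
  unfold tolerance
  simpa using (h.const_mul Cs).mul_const ((2 : ℝ) ^ m + 1)

/-- The exceptional initial values form a null set together with the event that the tolerance times
the amplification is not small, whose probability tends to zero as the amplification is a
random variable that does not depend on `T`. -/
theorem tendsto_measure_outputs_ne {n m : ℕ} (G : SimpleGraph (Fin n)) [DecidableRel G.Adj]
    (hn : n ≠ 0) {η : ℝ} {f : Fin n → Assign m → Fin 2} {σ : Fin n → Fin 2}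
    (hsat : (solutionSet f σ).Nonempty)
    {Ω : Type*} [MeasurableSpace Ω] {P : Measure Ω} [IsProbabilityMeasure P]
    {β : Fin n → Fin (2 ^ m + 1) → Ω → Vec (2 ^ m)} (hβ_meas : ∀ i s, Measurable (β i s))
    (hβ_unif : ∀ i s, pdf.IsUniform (β i s) (cube (2 ^ m)) P volume)
    (hβ_indep : iIndepFun (fun p : Fin n × Fin (2 ^ m + 1) => β p.1 p.2) P)
    {C₀ γ₀ Cs γs : ℝ} (hC₀ : 0 < C₀) (hres : ResidualBound G η f σ C₀ γ₀) (hCs : C₀ ≤ Cs)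
    (hγs₀ : 0 < γs) (hγs : γs ≤ γ₀) (i : Fin n) :
    Tendsto (fun T : ℕ => P {ω | outputs G η f σ Cs γs (fun k s => β k s ω) T i
      ≠ {solutionSet f σ}}) atTop (𝓝 0) := by
  obtain ⟨r, hr0, hr1, hr⟩ := exists_booleanVectors_gap (networkSpace_nonempty hsat)
  set Z : Ω → ℝ := fun ω => amplification (networkSpace f σ) (averages fun k s => β k s ω) with hZ
  have hZmeas : Measurable Z := (measurable_amplification _).comp (measurable_averages.comp
    (measurable_pi_lambda _ fun k => measurable_pi_lambda _ fun s => hβ_meas k s))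
  have hconv : TendstoInMeasure P (fun (T : ℕ) ω => 2 * tolerance m Cs γs T * Z ω) atTop
      (fun _ => 0) := by
    refine tendstoInMeasure_of_tendsto_ae
      (fun T => (hZmeas.const_mul _).aestronglyMeasurable) (ae_of_all _ fun ω => ?_)
    simpa using ((tendsto_tolerance m Cs hγs₀).const_mul 2).mul_const (Z ω)
  rw [tendstoInMeasure_iff_norm] at hconv
  refine tendsto_of_tendsto_of_tendsto_of_le_of_le tendsto_const_nhds (hconv r hr0)
    (fun _ => zero_le) fun T => measure_mono_ae ?_
  filter_upwards [ae_mem_cube hβ_meas hβ_unif, ae_det_ne_zero hn hβ_meas hβ_unif hβ_indep]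
    with ω hcube hdet hne
  by_contra hlt
  refine hne (outputs_eq_singleton G hn hsat hC₀ hres hCs hγs hr1 hr hcube hdet ?_ i)
  have hlt' : ‖2 * tolerance m Cs γs T * Z ω - 0‖ < r := not_le.1 hlt
  rw [sub_zero] at hlt'
  exact (le_abs_self _).trans_lt hlt'

end BoolNet

end

theorem theorem2 {n m : ℕ} (G : SimpleGraph (Fin n)) [DecidableRel G.Adj] (hG : G.Connected)
    (η : ℝ) (hη₀ : 0 < η) (hη₁ : η < 1 / (n : ℝ))
    (f : Fin n → BoolNet.Assign m → Fin 2) (σ : Fin n → Fin 2)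
    (hsat : (BoolNet.solutionSet f σ).Nonempty)
    {Ω : Type*} [MeasurableSpace Ω] (P : Measure Ω) [IsProbabilityMeasure P]
    (β : Fin n → Fin (2 ^ m + 1) → Ω → BoolNet.Vec (2 ^ m))
    (hβ_meas : ∀ i s, Measurable (β i s))
    (hβ_unif : ∀ i s, pdf.IsUniform (β i s) (BoolNet.cube (2 ^ m)) P volume)
    (hβ_indep : iIndepFun (fun p : Fin n × Fin (2 ^ m + 1) => β p.1 p.2) P) :
    (∃ C₀ > 0, ∃ γ₀ > 0, BoolNet.ResidualBound G η f σ C₀ γ₀) ∧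
    ∀ C₀ γ₀ : ℝ, 0 < C₀ → 0 < γ₀ → BoolNet.ResidualBound G η f σ C₀ γ₀ →
      ∀ Cs γs : ℝ, C₀ ≤ Cs → 0 < γs → γs ≤ γ₀ → ∀ i : Fin n,
        Tendsto (fun T : ℕ => P {ω | BoolNet.outputs G η f σ Cs γs (fun k s => β k s ω) T i
            = {BoolNet.solutionSet f σ}}) atTop (𝓝 1) ∧
        Tendsto (fun T : ℕ => P {ω | BoolNet.outputs G η f σ Cs γs (fun k s => β k s ω) T i
            ≠ {BoolNet.solutionSet f σ}}) atTop (𝓝 0) := by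
  refine ⟨BoolNet.exists_residualBound G hG hη₀ hη₁ hsat, ?_⟩
  intro C₀ γ₀ hC₀ _ hres Cs γs hCs hγs₀ hγs i
  have hne := BoolNet.tendsto_measure_outputs_ne G (Fin.pos i).ne' hsat hβ_meas hβ_unif hβ_indep
    hC₀ hres hCs hγs₀ hγs i
  refine ⟨?_, hne⟩
  -- The events need not be measurable, so subadditivity takes the place of additivity.
  have hsub : Tendsto (fun T : ℕ => 1 - P {ω | BoolNet.outputs G η f σ Cs γs
      (fun k s => β k s ω) T i ≠ {BoolNet.solutionSet f σ}}) atTop (𝓝 1) := by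
    simpa using ENNReal.Tendsto.sub tendsto_const_nhds hne (Or.inl ENNReal.one_ne_top)
  refine tendsto_of_tendsto_of_tendsto_of_le_of_le hsub tendsto_const_nhds (fun T => ?_)
    fun T => prob_le_one
  rw [tsub_le_iff_right, ← measure_univ (μ := P)]
  refine (measure_mono fun ω _ => ?_).trans (measure_union_le _ _)
  exact em _
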